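/- Let $\mathbb H=\mathbb R^2\oplus\mathbb R$ be the Heisenberg group with product $(x,y,z)(x',y',z')=(x+x',\,y+y',\,z+z'+\tfrac12(xy'-x'y))$ and left-invariant frame $X=\partial_x-\tfrac12y\,\partial_z$, $Y=\partial_y+\tfrac12x\,\partial_z$, $Z=\partial_z$. For $\varepsilon>0$ let $M_\varepsilon$ be $\mathbb R^3$ with the Riemannian metric making $(X,Y,\varepsilon Z)$ orthonormal, let $d_\varepsilon(\mathbf x,\mathbf y)$ be its distance, i.e. the infimum of $$\int_0^1\sqrt{|\dot\gamma^1_t|^2+|\dot\gamma^2_t|^2+\varepsilon^{-2}\bigl|\dot\gamma^3_t-\tfrac12(\gamma^1_t\dot\gamma^2_t-\dot\gamma^1_t\gamma^2_t)\bigr|^2}\,dt$$ over absolutely continuous curves $\gamma$ with $\gamma_0=\mathbf x$, $\gamma_1=\mathbf y$, and let $\boldsymbol\Omega^\varepsilon=C_0([0,1],M_\varepsilon)$ be the space of continuous paths started at $0$, with the uniform topology. For an absolutely continuous planar path $a$ with $a_0=0$ put $\Psi(a)_t=(a^1_t,a^2_t,\tfrac12\int_0^t(a^1_s\dot a^2_s-a^2_s\dot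 a^1_s)\,ds)$. For $h$ in the Cameron--Martin space $\mathcal H=W^{1,2}_0([0,1],\mathbb R^3)$, with $\|h\|_{\mathcal H}^2=\int_0^1|\dot h_t|^2\,dt$, and $\boldsymbol\omega\in\boldsymbol\Omega^\varepsilon$, put $T^\varepsilon_h\boldsymbol\omega=(0,0,\varepsilon h^3)\,\lim_{n\to\infty}\Psi(a_n+(h^1,h^2))$, where the $a_n$ are absolutely continuous planar paths started at $0$ such that $\Psi(a_n)\to\boldsymbol\omega$ uniformly; limits are uniform and the product is taken pointwise in $\mathbb H$. Let $C^\varepsilon_{\mathcal H}(\boldsymbol\omega,\tilde{\boldsymbol\omega})=\|h\|_{\mathcal H}$ if $\tilde{\boldsymbol\omega}=T^\varepsilon_h\boldsymbol\omega$ for some $h\in\mathcal H$, and $+\infty$ otherwise. For a Borel probability measure $\mu$ on a Polish space $E$, a cost $c\colon E\times E\to[0,\infty]$, $p\in[1,\infty)$ and $\alpha>0$, write $\mu\in\mathcal T_p(E,c,\alpha)$ if for every Borel probability measure $\nu$ on $E$ $$\Bigl(\inf_{\pi}\int c^p\,d\pi\Bigr)^{1/p}\le\sqrt{\tfrac2\alpha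 H(\nu\,\|\,\mu)},$$ the infimum running over all couplings $\pi$ of $\mu$ and $\nu$, where $H$ is the relative entropy. Let $B=(B^1,B^2,B^3)$ be a standard Brownian motion in $\mathbb R^3$, let $\mathbf B^\varepsilon$ be the Brownian motion on $M_\varepsilon$ that starts at $0$ and solves $d\mathbf B^\varepsilon=X(\mathbf B^\varepsilon)\,dB^1+Y(\mathbf B^\varepsilon)\,dB^2+\varepsilon Z\,dB^3$ on $[0,1]$ (Itô), and let $\boldsymbol\mu^\varepsilon$ be the law of $\mathbf B^\varepsilon$ on $\boldsymbol\Omega^\varepsilon$ and $\boldsymbol\mu^\varepsilon_1$ the law of $\mathbf B^\varepsilon_1$. **Proposition.** Let $p\in[1,2)$, $q=\frac{2p}{2-p}$ and $\|B\|_\infty=\sup_{t\in[0,1]}|(B^1_t,B^2_t)|$. Then $\|B\|_\infty\in L^q$, and the constants $$\alpha(\varepsilon,p)=\bigl(1+2\varepsilon^{-1}\,\mathbb E[\|B\|_\infty^q]^{1/q}\bigr)^{-2},\qquad\varepsilon>0,$$ are positive and satisfy $\lim_{\varepsilon\to0}\alpha(\varepsilon,p)=0$. Moreover, for every $\varepsilon>0$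 and $a>0$: if $\boldsymbol\mu^\varepsilon\in\mathcal T_2(\boldsymbol\Omega^\varepsilon,C^\varepsilon_{\mathcal H},a)$, then $\boldsymbol\mu^\varepsilon_1\in\mathcal T_p(M_\varepsilon,d_\varepsilon,a\,\alpha(\varepsilon,p))$. In particular, if $\boldsymbol\mu^\varepsilon\in\mathcal T_2(\boldsymbol\Omega^\varepsilon,C^\varepsilon_{\mathcal H},1)$, then $\boldsymbol\mu^\varepsilon_1\in\mathcal T_p(M_\varepsilon,d_\varepsilon,\alpha(\varepsilon,p))$. -/

import Mathlib

open MeasureTheory ProbabilityTheory Set Filter Topology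
open scoped NNReal ENNReal

noncomputable section

/-! ### Transport costs and cost-information inequalities -/

/-- The optimal transport cost `(inf_π ∫ c(x, y)^p dπ(x, y))^(1/p)`, the infimum running over all
couplings `π` of `μ` and `ν`. -/
def transportCost {E : Type*} [MeasurableSpace E] (c : E → E → ℝ≥0∞) (p : ℝ)
    (μ ν : Measure E) : ℝ≥0∞ :=
  (⨅ (π : Measure (E × E)) (_ : π.map Prod.fst = μ ∧ π.map Prod.snd = ν),
    ∫⁻ z, c z.1 z.2 ^ p ∂π) ^ (1 / p)

/-- The cost-information (Talagrand) inequality `μ ∈ 𝒯_p(E, c, α)`: for every probability measure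
`ν` on `E`, the transport cost from `μ` to `ν` is at most `√((2 / α) H(ν ‖ μ))`, where `H` is the
relative entropy (equal to `∞` unless `ν ≪ μ`). -/
def SatisfiesTp {E : Type*} [MeasurableSpace E] (p : ℝ) (c : E → E → ℝ≥0∞) (α : ℝ)
    (μ : Measure E) : Prop :=
  ∀ ν : Measure E, IsProbabilityMeasure ν →
    transportCost c p μ ν ≤
      (ENNReal.ofReal (2 / α) * InformationTheory.klDiv ν μ) ^ (1 / 2 : ℝ)

/-! ### The Heisenberg group and its Riemannian approximations -/

/-- The underlying space `ℝ² ⊕ ℝ` of the Heisenberg group and of all the manifolds `M_ε`, with the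
Euclidean topology; the coordinates `0, 1, 2` are `x, y, z`. -/
abbrev Heis : Type := Fin 3 → ℝ

/-- The Heisenberg group law. -/
def heisMul (x y : Heis) : Heis :=
  ![x 0 + y 0, x 1 + y 1, x 2 + y 2 + (x 0 * y 1 - y 0 * x 1) / 2]

/-- The left-invariant frame `X = ∂x - (y/2) ∂z`, `Y = ∂y + (x/2) ∂z`, `Z_ε = ε ∂z`, which is
orthonormal in the Riemannian metric of `M_ε`. -/
def frame (ε : ℝ) (i : Fin 3) (x : Heis) : Heis :=
  ![![1, 0, -(x 1 / 2)], ![0, 1, x 0 / 2], ![0, 0, ε]] i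

/-- The coefficients of a tangent vector `v` at `x` in the frame `(X, Y, Z_ε)`. -/
def frameCoeff (ε : ℝ) (x v : Heis) : Fin 3 → ℝ :=
  ![v 0, v 1, ε⁻¹ * (v 2 - (x 0 * v 1 - v 0 * x 1) / 2)]

/-- The frame is left-invariant: `X, Y, Z_ε` at `x` are the velocities of right translation of `x`
by the one-parameter groups in the directions `e₁, e₂, ε e₃`. -/
lemma heisMul_smul_frame_zero (ε s : ℝ) (i : Fin 3) (x : Heis) :
    heisMul x (s • frame ε i 0) = x + s • frame ε i x := by
  ext j
  fin_cases i <;> fin_cases j <;> simp [heisMul, frame] <;> ring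

lemma sum_frameCoeff_smul_frame {ε : ℝ} (hε : ε ≠ 0) (x v : Heis) :
    ∑ i, frameCoeff ε x v i • frame ε i x = v := by
  ext j
  fin_cases j <;> simp [Fin.sum_univ_three, frameCoeff, frame]
  field_simp
  ring

/-- The Riemannian length in `M_ε` of a curve `γ` parametrised by `[0, 1]`. -/
def riemLength (ε : ℝ) (γ : ℝ → Heis) : ℝ :=
  ∫ t in (0 : ℝ)..1, √(∑ i, frameCoeff ε (γ t) (fun j => deriv (fun s => γ s j) t) i ^ 2)

/-- The Riemannian distance `d_ε`: the infimum of the lengths of the absolutely continuous curves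
from `x` to `y`. -/
def riemDist (ε : ℝ) (x y : Heis) : ℝ :=
  sInf {l | ∃ γ : ℝ → Heis, AbsolutelyContinuousOnInterval γ 0 1 ∧ γ 0 = x ∧ γ 1 = y ∧
    l = riemLength ε γ}

/-! ### Path space -/

instance instMeasurableSpaceHeisPath : MeasurableSpace C(unitInterval, Heis) := borel _

instance instBorelSpaceHeisPath : BorelSpace C(unitInterval, Heis) := ⟨rfl⟩

/-- The space `C₀([0, 1], M_ε)` of continuous paths started at the origin, with the topology of
uniform convergence and its Borel σ-algebra. (The distances `d_ε` all induce the Euclidean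
topology, so this space is the same one for all `ε`.) -/
abbrev PathSpace : Type := {ω : C(unitInterval, Heis) // ω 0 = 0}

/-- Planar absolutely continuous paths on `[0, 1]` started at the origin. -/
def IsAC₀ (a : ℝ → Fin 2 → ℝ) : Prop :=
  AbsolutelyContinuousOnInterval a 0 1 ∧ a 0 = 0

/-- The canonical lift of a planar absolutely continuous path to a horizontal path in the
Heisenberg group: the third coordinate is the signed area swept out by the path. -/
def canonicalLift (a : ℝ → Fin 2 → ℝ) (t : ℝ) : Heis :=
  ![a t 0, a t 1,
    (∫ s in (0 : ℝ)..t, (a s 0 * deriv (fun r => a r 1) s - a s 1 * deriv (fun r => a r 0) s)) / 2]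

/-- `η = T_h ω`, for a planar path `h`: there are lifts of absolutely continuous planar paths
`a n` that converge to `ω` uniformly on `[0, 1]`, and `η` is the uniform limit of the lifts of
`a n + h`. -/
def IsShift (h : ℝ → Fin 2 → ℝ) (ω η : PathSpace) : Prop :=
  ∃ a : ℕ → ℝ → Fin 2 → ℝ, (∀ n, IsAC₀ (a n)) ∧
    TendstoUniformly (fun n (t : unitInterval) => canonicalLift (a n) t) ω.1 atTop ∧
    TendstoUniformly (fun n (t : unitInterval) => canonicalLift (a n + h) t) η.1 atTop

/-- `η = T^ε_h ω`, for `h = (h¹, h², h³)`: the path `η` is the pointwise group product of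
`(0, 0, ε h³)` and `T_{(h¹, h²)} ω`. -/
def IsEpsShift (ε : ℝ) (h : ℝ → Fin 3 → ℝ) (ω η : PathSpace) : Prop :=
  ∃ ζ : PathSpace, IsShift (fun t => ![h t 0, h t 1]) ω ζ ∧
    ∀ t : unitInterval, η.1 t = heisMul ![0, 0, ε * h t 2] (ζ.1 t)

/-- Membership in the Cameron-Martin space `W^{1,2}_0([0, 1], ℝ³)`. -/
def IsCameronMartin (h : ℝ → Fin 3 → ℝ) : Prop :=
  AbsolutelyContinuousOnInterval h 0 1 ∧ h 0 = 0 ∧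
    ∀ i, MemLp (deriv fun t => h t i) 2 (volume.restrict (Icc 0 1))

/-- The Cameron-Martin norm, `(∫₀¹ |h'(t)|² dt)^(1/2)` with the Euclidean norm of `ℝ³`. -/
def cameronMartinNorm (h : ℝ → Fin 3 → ℝ) : ℝ :=
  √(∫ t in (0 : ℝ)..1, ∑ i, deriv (fun s => h s i) t ^ 2)

/-- The cost `C^ε_ℋ` on path space: it is `‖h‖_ℋ` if `η = T^ε_h ω` with `h` in the Cameron-Martin
space (such an `h` is determined by `ω` and `η` on `[0, 1]`), and `∞` if there is no such `h`. -/
def cameronMartinCost (ε : ℝ) (ω η : PathSpace) : ℝ≥0∞ :=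
  ⨅ (h : ℝ → Fin 3 → ℝ) (_ : IsCameronMartin h ∧ IsEpsShift ε h ω η),
    ENNReal.ofReal (cameronMartinNorm h)

/-! ### Brownian motion -/

/-- `B` is a standard Brownian motion in `ℝ³`. -/
def IsBrownianThree {Ω : Type*} [MeasurableSpace Ω] (B : Fin 3 → ℝ≥0 → Ω → ℝ)
    (P : Measure Ω) : Prop :=
  (∀ i, IsBrownianReal (B i) P) ∧ iIndepFun (fun i ω t => B i t ω) P

/-- The point `t k / n` for `k ≤ n`. -/
def gridPoint (t : unitInterval) (n k : ℕ) : unitInterval :=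
  t * Set.projIcc (0 : ℝ) 1 zero_le_one (k / n)

/-- `J` is the Itô integral `∫ X dW` over `[0, t]`, for every `t ∈ [0, 1]`, of a continuous adapted
integrand `X` with respect to a Brownian motion `W`: the limit in probability of the Riemann sums
with left endpoints. -/
def IsItoIntegral {Ω : Type*} [MeasurableSpace Ω] (P : Measure Ω)
    (X : unitInterval → Ω → Heis) (W : ℝ≥0 → Ω → ℝ) (J : unitInterval → Ω → Heis) : Prop :=
  ∀ t : unitInterval, TendstoInMeasure P
    (fun (n : ℕ) ω => ∑ k ∈ Finset.range n,
      (W (unitInterval.toNNReal (gridPoint t n (k + 1))) ω -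
        W (unitInterval.toNNReal (gridPoint t n k)) ω) • X (gridPoint t n k) ω)
    atTop (J t)

/-- `Bb` is the Brownian motion on `M_ε` driven by the Brownian motion `B` of `ℝ³`: a random
continuous path started at the origin which solves the stochastic differential equation
`dBb = X(Bb) dB¹ + Y(Bb) dB² + Z_ε dB³` on `[0, 1]`. -/
def IsRiemBrownian {Ω : Type*} [MeasurableSpace Ω] (ε : ℝ) (B : Fin 3 → ℝ≥0 → Ω → ℝ)
    (Bb : Ω → PathSpace) (P : Measure Ω) : Prop :=
  AEMeasurable Bb P ∧
    ∃ J : Fin 3 → unitInterval → Ω → Heis,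
      (∀ i, IsItoIntegral P (fun t ω => frame ε i ((Bb ω).1 t)) (B i) (J i)) ∧
      ∀ t, ∀ᵐ ω ∂P, (Bb ω).1 t = ∑ i, J i t ω

/-- The supremum over `[0, 1]` of the Euclidean norm of the planar part `(B¹, B²)`. -/
def planarSup {Ω : Type*} (B : Fin 3 → ℝ≥0 → Ω → ℝ) (ω : Ω) : ℝ :=
  ⨆ t : unitInterval, √(B 0 (unitInterval.toNNReal t) ω ^ 2 + B 1 (unitInterval.toNNReal t) ω ^ 2)

/-- The exponent `q = 2p / (2 - p)`. -/
def dualExponent (p : ℝ) : ℝ≥0∞ := ENNReal.ofReal (2 * p / (2 - p))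

/-- The constant `α(ε, p) = (1 + 2 ε⁻¹ ‖sup |(B¹, B²)|‖_{L^q})⁻²` with `q = 2p / (2 - p)`. -/
def projConst {Ω : Type*} [MeasurableSpace Ω] (P : Measure Ω) (B : Fin 3 → ℝ≥0 → Ω → ℝ)
    (ε p : ℝ) : ℝ :=
  ((1 + 2 * ε⁻¹ * (eLpNorm (planarSup B) (dualExponent p) P).toReal) ^ 2)⁻¹

end

/-!
The proof pushes the inequality on path space forward under the endpoint map `ω ↦ ω 1`.

Along a Cameron-Martin shift this map is Lipschitz with a constant that depends on the path. If
`η = T^ε_h ω`, integration by parts removes the derivatives of the approximating paths from the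
area of `a n + h`, so that the displacement of the endpoint passes to the limit
(`IsEpsShift.apply_one_two`): up to left translation by `ω 1` it has planar part `(h¹, h²)` and
vertical part `ε h³ + A(h) + ∫ (ω_s - ω_1) × dh_s`, where `A(h)` is the area of `h`. The curve
`bridge` realises this displacement; its velocity has the coefficients of `h'` in the
frame of `M_ε`, except that the third one is increased by `ε⁻¹ (ω_s - ω_1) × h'_s`. Hence its length is at most
`(1 + 2 ε⁻¹ sup |ω|) ‖h‖`, with the supremum of the planar part of `ω`
(`riemDist_le_mul_cameronMartinCost`).

A Lipschitz constant `K` in `L^q` turns `𝒯₂` into `𝒯_p` when `1 / p = 1 / q + 1 / 2`: a measure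
`ν ≪ μ ∘ e⁻¹` lifts to a measure of the same entropy, and Hölder's inequality bounds
`‖d‖_{L^p}` by `‖K‖_{L^q} ‖c‖_{L²}` for each coupling (`SatisfiesTp.map`).

It remains to compute with the law of the Brownian motion on `M_ε`. The planar parts of the frame
are constant, so the Riemann sums of the planar coordinates telescope and the planar part of the
solution is `(B¹, B²)` (`IsRiemBrownian.ae_planar`). The supremum of planar Brownian motion has
moments of all orders by chaining over dyadic points (`IsBrownianThree.memLp_planarSup`), and it
is not almost surely zero, whence the behaviour of the constants as `ε → 0`.
-/

/-! ### Absolutely continuous curves and stochastic area -/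

lemma absolutelyContinuousOnInterval_pi {ι : Type*} [Fintype ι] {f : ℝ → ι → ℝ} {a b : ℝ} :
    AbsolutelyContinuousOnInterval f a b ↔
      ∀ i, AbsolutelyContinuousOnInterval (fun t => f t i) a b := by
  refine ⟨fun hf i => ?_, fun hf => ?_⟩
  · exact squeeze_zero (fun E => Finset.sum_nonneg fun _ _ => dist_nonneg)
      (fun E => Finset.sum_le_sum fun j _ => dist_le_pi_dist _ _ i) hf
  · refine squeeze_zero (fun E => Finset.sum_nonneg fun _ _ => dist_nonneg)
      (g := fun E : ℕ × (ℕ → ℝ × ℝ) => ∑ i, ∑ j ∈ Finset.range E.1,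
        dist (f (E.2 j).1 i) (f (E.2 j).2 i)) (fun E => ?_) ?_
    · rw [Finset.sum_comm]
      refine Finset.sum_le_sum fun j _ => ?_
      refine (dist_pi_le_iff (Finset.sum_nonneg fun _ _ => dist_nonneg)).2 fun i => ?_
      exact Finset.single_le_sum (f := fun i => dist (f (E.2 j).1 i) (f (E.2 j).2 i))
        (fun _ _ => dist_nonneg) (Finset.mem_univ i)
    · simpa using tendsto_finsetSum Finset.univ fun i _ => hf i

lemma AbsolutelyContinuousOnInterval.intervalIntegrable_mul_deriv {f g : ℝ → ℝ} {a b : ℝ}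
    (hf : AbsolutelyContinuousOnInterval f a b) (hg : AbsolutelyContinuousOnInterval g a b) :
    IntervalIntegrable (fun s => f s * deriv g s) volume a b :=
  hg.intervalIntegrable_deriv.continuousOn_mul hf.continuousOn

/-- The area swept out by a sum of two planar curves: the mixed terms are brought to a form in
which only the second curve is differentiated. -/
lemma integral_area_add {a₀ a₁ h₀ h₁ : ℝ → ℝ}
    (ha₀ : AbsolutelyContinuousOnInterval a₀ 0 1) (ha₁ : AbsolutelyContinuousOnInterval a₁ 0 1)
    (hh₀ : AbsolutelyContinuousOnInterval h₀ 0 1) (hh₁ : AbsolutelyContinuousOnInterval h₁ 0 1)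
    (z₀ : h₀ 0 = 0) (z₁ : h₁ 0 = 0) :
    ∫ s in (0 : ℝ)..1, ((a₀ s + h₀ s) * deriv (fun r => a₁ r + h₁ r) s -
        (a₁ s + h₁ s) * deriv (fun r => a₀ r + h₀ r) s) =
      (∫ s in (0 : ℝ)..1, (a₀ s * deriv a₁ s - a₁ s * deriv a₀ s)) +
      (∫ s in (0 : ℝ)..1, (h₀ s * deriv h₁ s - h₁ s * deriv h₀ s)) +
      2 * (∫ s in (0 : ℝ)..1, a₀ s * deriv h₁ s) - 2 * (∫ s in (0 : ℝ)..1, a₁ s * deriv h₀ s) +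
      (h₀ 1 * a₁ 1 - h₁ 1 * a₀ 1) := by
  -- Only almost everywhere do both summands have a derivative.
  have key : ∫ s in (0 : ℝ)..1, ((a₀ s + h₀ s) * deriv (fun r => a₁ r + h₁ r) s -
        (a₁ s + h₁ s) * deriv (fun r => a₀ r + h₀ r) s) =
      ∫ s in (0 : ℝ)..1, ((a₀ s * deriv a₁ s - a₁ s * deriv a₀ s) +
        (h₀ s * deriv h₁ s - h₁ s * deriv h₀ s) + (a₀ s * deriv h₁ s - a₁ s * deriv h₀ s) +
        (h₀ s * deriv a₁ s - h₁ s * deriv a₀ s)) := by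
    refine intervalIntegral.integral_congr_ae ?_
    filter_upwards [ha₀.ae_differentiableAt, ha₁.ae_differentiableAt, hh₀.ae_differentiableAt,
      hh₁.ae_differentiableAt] with s d₀ d₁ e₀ e₁ hs
    have hs' := uIoc_subset_uIcc hs
    rw [deriv_fun_add (d₁ hs') (e₁ hs'), deriv_fun_add (d₀ hs') (e₀ hs')]
    ring
  have p₀ := hh₀.integral_mul_deriv_eq_deriv_mul ha₁
  have p₁ := hh₁.integral_mul_deriv_eq_deriv_mul ha₀
  simp only [mul_comm (deriv h₀ _), mul_comm (deriv h₁ _)] at p₀ p₁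
  have I {f g : ℝ → ℝ} (hf : AbsolutelyContinuousOnInterval f 0 1)
      (hg : AbsolutelyContinuousOnInterval g 0 1) := hf.intervalIntegrable_mul_deriv hg
  have ia := (I ha₀ ha₁).sub (I ha₁ ha₀)
  have ih := (I hh₀ hh₁).sub (I hh₁ hh₀)
  have im := (I ha₀ hh₁).sub (I ha₁ hh₀)
  rw [key, intervalIntegral.integral_add ((ia.add ih).add im) ((I hh₀ ha₁).sub (I hh₁ ha₀)),
    intervalIntegral.integral_add (ia.add ih) im, intervalIntegral.integral_add ia ih,
    intervalIntegral.integral_sub (I ha₀ hh₁) (I ha₁ hh₀),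
    intervalIntegral.integral_sub (I hh₀ ha₁) (I hh₁ ha₀), p₀, p₁, z₀, z₁]
  ring

lemma tendsto_integral_mul_of_tendstoUniformly {a : ℕ → ℝ → ℝ} {w : C(unitInterval, ℝ)}
    {g : ℝ → ℝ} (ha : ∀ n, ContinuousOn (a n) (uIcc 0 1))
    (hg : IntervalIntegrable g volume 0 1)
    (h : TendstoUniformly (fun n (t : unitInterval) => a n t) w atTop) :
    Tendsto (fun n => ∫ s in (0 : ℝ)..1, a n s * g s) atTop
      (𝓝 (∫ s in (0 : ℝ)..1, w (projIcc 0 1 zero_le_one s) * g s)) := by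
  refine intervalIntegral.tendsto_integral_filter_of_dominated_convergence
    (fun s => (‖w‖ + 1) * ‖g s‖) ?_ ?_ (hg.norm.const_mul _) ?_
  · exact .of_forall fun n => by
      rw [uIoc_of_le zero_le_one]
      exact (hg.continuousOn_mul (ha n)).1.aestronglyMeasurable
  · filter_upwards [Metric.tendstoUniformly_iff.1 h 1 one_pos] with n hn
    refine .of_forall fun s hs => ?_
    rw [uIoc_of_le zero_le_one] at hs
    have hs' : s ∈ Icc (0 : ℝ) 1 := Ioc_subset_Icc_self hs
    rw [norm_mul]
    gcongr
    have h1 := hn ⟨s, hs'⟩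
    have h2 := w.norm_coe_le_norm ⟨s, hs'⟩
    rw [dist_comm, dist_eq_norm] at h1
    have h3 := norm_add_le (a n s - w ⟨s, hs'⟩) (w ⟨s, hs'⟩)
    simp only [sub_add_cancel] at h3
    linarith
  · refine .of_forall fun s hs => ?_
    rw [uIoc_of_le zero_le_one] at hs
    have hs' : s ∈ Icc (0 : ℝ) 1 := Ioc_subset_Icc_self hs
    rw [projIcc_of_mem zero_le_one hs']
    exact (h.tendsto_at ⟨s, hs'⟩).mul_const _

/-- The coordinate `i` of a path in `ℝ³`. -/
def pathCoord (i : Fin 3) (ω : PathSpace) : C(unitInterval, ℝ) :=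
  ⟨fun t => ω.1 t i, by fun_prop⟩

lemma TendstoUniformly.apply_pi {α ι κ : Type*} [Fintype κ] {F : ι → α → κ → ℝ} {f : α → κ → ℝ}
    {l : Filter ι} (h : TendstoUniformly F f l) (i : κ) :
    TendstoUniformly (fun n t => F n t i) (fun t => f t i) l := by
  rw [Metric.tendstoUniformly_iff] at h ⊢
  intro δ hδ
  filter_upwards [h δ hδ] with n hn t
  exact (dist_le_pi_dist _ _ i).trans_lt (hn t)

section Shift

variable {ε : ℝ} {h : ℝ → Fin 3 → ℝ} {ω η : PathSpace}

lemma IsCameronMartin.ac (hh : IsCameronMartin h) (i : Fin 3) :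
    AbsolutelyContinuousOnInterval (fun t => h t i) 0 1 :=
  absolutelyContinuousOnInterval_pi.1 hh.1 i

lemma IsEpsShift.apply_one_zero (H : IsEpsShift ε h ω η) :
    η.1 1 0 = ω.1 1 0 + h 1 0 := by
  obtain ⟨ζ, ⟨a, -, h₁, h₂⟩, h₃⟩ := H
  have e₁ := ((h₁.apply_pi 0).tendsto_at 1).add_const (h 1 0)
  have e₂ := (h₂.apply_pi 0).tendsto_at 1
  simp only [canonicalLift, Set.Icc.coe_one, Pi.add_apply, Matrix.cons_val_zero] at e₁ e₂
  rw [h₃, tendsto_nhds_unique e₁ e₂]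
  simp [heisMul]

lemma IsEpsShift.apply_one_one (H : IsEpsShift ε h ω η) :
    η.1 1 1 = ω.1 1 1 + h 1 1 := by
  obtain ⟨ζ, ⟨a, -, h₁, h₂⟩, h₃⟩ := H
  have e₁ := ((h₁.apply_pi 1).tendsto_at 1).add_const (h 1 1)
  have e₂ := (h₂.apply_pi 1).tendsto_at 1
  simp only [canonicalLift, Set.Icc.coe_one, Pi.add_apply, Matrix.cons_val_zero,
    Matrix.cons_val_one] at e₁ e₂
  rw [h₃, tendsto_nhds_unique e₁ e₂]
  simp [heisMul]

/-- The vertical coordinate of the shifted endpoint: besides `ε h³`, only the area of `h`, the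
integral of `ω` against `h'` and endpoint values enter, so that it is continuous in `ω` for the
uniform topology. -/
lemma IsEpsShift.apply_one_two (hh : IsCameronMartin h) (H : IsEpsShift ε h ω η) :
    η.1 1 2 = ω.1 1 2 + ε * h 1 2 +
      (∫ s in (0 : ℝ)..1, (h s 0 * deriv (fun r => h r 1) s - h s 1 * deriv (fun r => h r 0) s)) / 2
      + (∫ s in (0 : ℝ)..1, pathCoord 0 ω (projIcc 0 1 zero_le_one s) * deriv (fun r => h r 1) s)
      - (∫ s in (0 : ℝ)..1, pathCoord 1 ω (projIcc 0 1 zero_le_one s) * deriv (fun r => h r 0) s)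
      + (h 1 0 * ω.1 1 1 - h 1 1 * ω.1 1 0) / 2 := by
  obtain ⟨ζ, ⟨a, ha, h₁, h₂⟩, h₃⟩ := H
  have hac n i : AbsolutelyContinuousOnInterval (fun t => a n t i) 0 1 :=
    absolutelyContinuousOnInterval_pi.1 (ha n).1 i
  have z i : h 0 i = 0 := by rw [hh.2.1]; rfl
  have u₀ := h₁.apply_pi 0
  have u₁ := h₁.apply_pi 1
  have e₂ := (h₁.apply_pi 2).tendsto_at 1
  have f₂ := (h₂.apply_pi 2).tendsto_at 1
  have I₀ := tendsto_integral_mul_of_tendstoUniformly (a := fun n t => a n t 0)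
    (w := pathCoord 0 ω) (fun n => (hac n 0).continuousOn)
    (hh.ac 1).intervalIntegrable_deriv u₀
  have I₁ := tendsto_integral_mul_of_tendstoUniformly (a := fun n t => a n t 1)
    (w := pathCoord 1 ω) (fun n => (hac n 1).continuousOn)
    (hh.ac 0).intervalIntegrable_deriv u₁
  have e₀ := u₀.tendsto_at 1
  have e₁ := u₁.tendsto_at 1
  simp only [canonicalLift, Set.Icc.coe_one, Pi.add_apply, Matrix.cons_val,
    Matrix.cons_val_one, Matrix.cons_val_zero] at e₀ e₁ e₂ f₂
  have key := ((((e₂.add_const ((∫ s in (0 : ℝ)..1,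
    (h s 0 * deriv (fun r => h r 1) s - h s 1 * deriv (fun r => h r 0) s)) / 2)).add I₀).sub
    I₁).add (((e₁.const_mul (h 1 0)).sub (e₀.const_mul (h 1 1))).div_const 2))
  have hζ := tendsto_nhds_unique f₂ (key.congr fun n => by
    rw [integral_area_add (hac n 0) (hac n 1) (hh.ac 0) (hh.ac 1) (z 0) (z 1)]
    ring)
  rw [h₃]
  simp only [heisMul, Matrix.cons_val, hζ]
  simp
  ring

/-! ### The distance between the endpoints of a path and of its shift -/

/-- The supremum over `[0, 1]` of the Euclidean norm of the planar part of a path. -/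
noncomputable def pathPlanarSup (ω : PathSpace) : ℝ :=
  ⨆ t : unitInterval, √(ω.1 t 0 ^ 2 + ω.1 t 1 ^ 2)

lemma sqrt_le_pathPlanarSup (ω : PathSpace) (t : unitInterval) :
    √(ω.1 t 0 ^ 2 + ω.1 t 1 ^ 2) ≤ pathPlanarSup ω := by
  refine le_ciSup (f := fun t : unitInterval => √(ω.1 t 0 ^ 2 + ω.1 t 1 ^ 2)) ?_ t
  exact (isCompact_range (by fun_prop)).bddAbove

lemma pathPlanarSup_nonneg (ω : PathSpace) : 0 ≤ pathPlanarSup ω :=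
  Real.iSup_nonneg fun _ => Real.sqrt_nonneg _

lemma riemLength_nonneg (ε : ℝ) (γ : ℝ → Heis) : 0 ≤ riemLength ε γ :=
  intervalIntegral.integral_nonneg zero_le_one fun _ _ => Real.sqrt_nonneg _

lemma riemDist_le_riemLength {ε : ℝ} {x y : Heis} {γ : ℝ → Heis}
    (hγ : AbsolutelyContinuousOnInterval γ 0 1) (h0 : γ 0 = x) (h1 : γ 1 = y) :
    riemDist ε x y ≤ riemLength ε γ :=
  csInf_le ⟨0, by rintro _ ⟨γ, -, -, -, rfl⟩; exact riemLength_nonneg ε γ⟩ ⟨γ, hγ, h0, h1, rfl⟩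

/-- The Minkowski inequality in the form used for the speed of a curve whose vertical component
has an additional term `u × (x, y)`, where `u` is a difference of two vectors of norm at
most `S`. -/
lemma sqrt_sq_add_cross_le {a₀ a₁ b₀ b₁ S δ x y z : ℝ} (hδ : 0 ≤ δ) (hS : 0 ≤ S)
    (ha : √(a₀ ^ 2 + a₁ ^ 2) ≤ S) (hb : √(b₀ ^ 2 + b₁ ^ 2) ≤ S) :
    √(x ^ 2 + y ^ 2 + (z + δ * ((a₀ - b₀) * y - (a₁ - b₁) * x)) ^ 2) ≤
      (1 + 2 * δ * S) * √(x ^ 2 + y ^ 2 + z ^ 2) := by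
  rw [Real.sqrt_le_left hS] at ha hb
  set N := √(x ^ 2 + y ^ 2 + z ^ 2) with hN
  have hN0 : 0 ≤ N := Real.sqrt_nonneg _
  have hN2 : N ^ 2 = x ^ 2 + y ^ 2 + z ^ 2 := Real.sq_sqrt (by positivity)
  have hu : (a₀ - b₀) ^ 2 + (a₁ - b₁) ^ 2 ≤ (2 * S) ^ 2 := by
    nlinarith [sq_nonneg (a₀ + b₀), sq_nonneg (a₁ + b₁)]
  have hc2 : ((a₀ - b₀) * y - (a₁ - b₁) * x) ^ 2 ≤ (2 * S * N) ^ 2 := by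
    calc ((a₀ - b₀) * y - (a₁ - b₁) * x) ^ 2
        ≤ ((a₀ - b₀) ^ 2 + (a₁ - b₁) ^ 2) * (x ^ 2 + y ^ 2) := by
          nlinarith [sq_nonneg ((a₀ - b₀) * x + (a₁ - b₁) * y)]
      _ ≤ (2 * S) ^ 2 * N ^ 2 := by
          gcongr
          nlinarith [sq_nonneg z]
      _ = _ := by ring
  have hc := abs_le_of_sq_le_sq hc2 (by positivity)
  generalize (a₀ - b₀) * y - (a₁ - b₁) * x = c at hc hc2
  have hz : |z| ≤ N := abs_le_of_sq_le_sq (by nlinarith [sq_nonneg x, sq_nonneg y]) hN0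
  refine Real.sqrt_le_iff.2 ⟨by positivity, ?_⟩
  have hzc : z * c ≤ N * (2 * S * N) :=
    (le_abs_self _).trans (by rw [abs_mul]; gcongr)
  calc x ^ 2 + y ^ 2 + (z + δ * c) ^ 2
      = N ^ 2 + 2 * δ * (z * c) + δ ^ 2 * c ^ 2 := by rw [hN2]; ring
    _ ≤ N ^ 2 + 2 * δ * (N * (2 * S * N)) + δ ^ 2 * (2 * S * N) ^ 2 := by gcongr
    _ = _ := by ring

lemma IsCameronMartin.integrable_sum_sq (hh : IsCameronMartin h) :
    Integrable (fun t => ∑ i, deriv (fun s => h s i) t ^ 2)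
      (volume.restrict (Ioc (0 : ℝ) 1)) :=
  integrable_finsetSum _ fun i _ =>
    ((hh.2.2 i).mono_measure (Measure.restrict_mono Ioc_subset_Icc_self le_rfl)).integrable_sq

/-- By the Cauchy-Schwarz inequality on `[0, 1]`, the variation of `h` is at most its
Cameron-Martin norm. -/
lemma IsCameronMartin.integral_sqrt_le (hh : IsCameronMartin h) :
    Integrable (fun t => √(∑ i, deriv (fun s => h s i) t ^ 2))
      (volume.restrict (Ioc (0 : ℝ) 1)) ∧
    ∫ t in (0 : ℝ)..1, √(∑ i, deriv (fun s => h s i) t ^ 2) ≤ cameronMartinNorm h := by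
  have : IsProbabilityMeasure (volume.restrict (Ioc (0 : ℝ) 1)) := ⟨by simp⟩
  have hI := hh.integrable_sum_sq
  have hL : MemLp (fun t => √(∑ i, deriv (fun s => h s i) t ^ 2)) 2
      (volume.restrict (Ioc (0 : ℝ) 1)) := by
    refine (memLp_two_iff_integrable_sq
      (Real.continuous_sqrt.comp_aestronglyMeasurable hI.aestronglyMeasurable)).2 ?_
    refine hI.congr (.of_forall fun t => ?_)
    exact (Real.sq_sqrt (Finset.sum_nonneg fun _ _ => sq_nonneg _)).symm
  refine ⟨hL.integrable (by norm_num), ?_⟩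
  rw [cameronMartinNorm, intervalIntegral.integral_of_le zero_le_one,
    intervalIntegral.integral_of_le zero_le_one]
  refine Real.le_sqrt_of_sq_le ?_
  have hv := variance_nonneg (fun t => √(∑ i, deriv (fun s => h s i) t ^ 2))
    (volume.restrict (Ioc (0 : ℝ) 1))
  rw [variance_eq_sub hL] at hv
  refine (sub_nonneg.1 hv).trans_eq (integral_congr_ae (.of_forall fun t => ?_))
  exact Real.sq_sqrt (Finset.sum_nonneg fun _ _ => sq_nonneg _)

lemma absolutelyContinuousOnInterval_const (c a b : ℝ) :
    AbsolutelyContinuousOnInterval (fun _ => c) a b :=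
  contDiffOn_const.absolutelyContinuousOnInterval

/-- The vertical velocity of the curve that joins the endpoint of `ω` to the endpoint of
`T^ε_h ω`. -/
noncomputable def bridgeVelocity (ε : ℝ) (h : ℝ → Fin 3 → ℝ) (ω : PathSpace) (s : ℝ) : ℝ :=
  ((ω.1 1 0 + h s 0) * deriv (fun r => h r 1) s - (ω.1 1 1 + h s 1) * deriv (fun r => h r 0) s) / 2
    + ε * deriv (fun r => h r 2) s
    + ((pathCoord 0 ω (projIcc 0 1 zero_le_one s) - ω.1 1 0) * deriv (fun r => h r 1) s
      - (pathCoord 1 ω (projIcc 0 1 zero_le_one s) - ω.1 1 1) * deriv (fun r => h r 0) s)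

/-- The curve `ω₁ · (h¹_t, h²_t, ε h³_t + A(h)_t + ∫₀ᵗ (ω_s - ω₁) × dh_s)` that joins the endpoint
of `ω` to the endpoint of `T^ε_h ω`. The last integral accounts for the change of the area of `ω`
under the shift; it is the only vertical motion that does not come from `h³`. -/
noncomputable def bridge (ε : ℝ) (h : ℝ → Fin 3 → ℝ) (ω : PathSpace) (t : ℝ) : Heis :=
  ![ω.1 1 0 + h t 0, ω.1 1 1 + h t 1, ω.1 1 2 + ∫ s in (0 : ℝ)..t, bridgeVelocity ε h ω s]

lemma intervalIntegrable_pathCoord_mul (hh : IsCameronMartin h) (i j : Fin 3) :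
    IntervalIntegrable (fun s => pathCoord i ω (projIcc 0 1 zero_le_one s) *
      deriv (fun r => h r j) s) volume 0 1 :=
  (hh.ac j).intervalIntegrable_deriv.continuousOn_mul
    (g := fun s => pathCoord i ω (projIcc 0 1 zero_le_one s))
    ((pathCoord i ω).continuous.comp continuous_projIcc).continuousOn

lemma bridgeVelocity_eq (ε : ℝ) (h : ℝ → Fin 3 → ℝ) (ω : PathSpace) :
    bridgeVelocity ε h ω = fun s =>
      1 / 2 * (h s 0 * deriv (fun r => h r 1) s - h s 1 * deriv (fun r => h r 0) s)
      + ε * deriv (fun r => h r 2) s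
      + (pathCoord 0 ω (projIcc 0 1 zero_le_one s) * deriv (fun r => h r 1) s
        - pathCoord 1 ω (projIcc 0 1 zero_le_one s) * deriv (fun r => h r 0) s)
      + (ω.1 1 1 / 2 * deriv (fun r => h r 0) s - ω.1 1 0 / 2 * deriv (fun r => h r 1) s) := by
  ext s
  rw [bridgeVelocity]
  ring

lemma intervalIntegrable_bridgeVelocity (hh : IsCameronMartin h) :
    IntervalIntegrable (bridgeVelocity ε h ω) volume 0 1 := by
  rw [bridgeVelocity_eq]
  have d i := (hh.ac i).intervalIntegrable_deriv
  have m i j := (hh.ac i).intervalIntegrable_mul_deriv (hh.ac j)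
  exact (((((m 0 1).sub (m 1 0)).const_mul _).add ((d 2).const_mul _)).add
    ((intervalIntegrable_pathCoord_mul hh 0 1).sub (intervalIntegrable_pathCoord_mul hh 1 0))).add
    (((d 0).const_mul _).sub ((d 1).const_mul _))

lemma bridge_zero (hh : IsCameronMartin h) : bridge ε h ω 0 = ω.1 1 := by
  ext i
  fin_cases i <;> simp [bridge, hh.2.1]

lemma bridge_one (hh : IsCameronMartin h) (H : IsEpsShift ε h ω η) :
    bridge ε h ω 1 = η.1 1 := by
  have z i : h 0 i = 0 := by rw [hh.2.1]; rfl
  have d i := (hh.ac i).intervalIntegrable_deriv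
  have m i j := (hh.ac i).intervalIntegrable_mul_deriv (hh.ac j)
  have p i j := intervalIntegrable_pathCoord_mul (ω := ω) hh i j
  have ftc i : ∫ s in (0 : ℝ)..1, deriv (fun r => h r i) s = h 1 i := by
    rw [(hh.ac i).integral_deriv_eq_sub, z, sub_zero]
  ext i
  fin_cases i
  · simp [bridge, H.apply_one_zero]
  · simp [bridge, H.apply_one_one]
  · have i₁ := ((m 0 1).sub (m 1 0)).const_mul (1 / 2)
    have i₂ := (d 2).const_mul ε
    have i₃ := (p 0 1).sub (p 1 0)
    have i₄ := ((d 0).const_mul (ω.1 1 1 / 2)).sub ((d 1).const_mul (ω.1 1 0 / 2))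
    simp only [bridge, Fin.reduceFinMk, Matrix.cons_val, H.apply_one_two hh, bridgeVelocity_eq]
    rw [intervalIntegral.integral_add ((i₁.add i₂).add i₃) i₄,
      intervalIntegral.integral_add (i₁.add i₂) i₃, intervalIntegral.integral_add i₁ i₂,
      intervalIntegral.integral_sub (p 0 1) (p 1 0),
      intervalIntegral.integral_sub ((d 0).const_mul _) ((d 1).const_mul _)]
    simp only [intervalIntegral.integral_const_mul, ftc]
    ring

lemma absolutelyContinuousOnInterval_bridge (hh : IsCameronMartin h) :
    AbsolutelyContinuousOnInterval (bridge ε h ω) 0 1 := by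
  refine absolutelyContinuousOnInterval_pi.2 fun i => ?_
  have c := fun i => absolutelyContinuousOnInterval_const (ω.1 1 i) 0 1
  fin_cases i
  · exact (c 0).fun_add (hh.ac 0)
  · exact (c 1).fun_add (hh.ac 1)
  · exact (c 2).fun_add ((intervalIntegrable_bridgeVelocity
      hh).absolutelyContinuousOnInterval_intervalIntegral left_mem_uIcc)

lemma riemLength_bridge_le (hε : 0 < ε) (hh : IsCameronMartin h) :
    riemLength ε (bridge ε h ω) ≤ (1 + 2 * ε⁻¹ * pathPlanarSup ω) * cameronMartinNorm h := by
  obtain ⟨hI, hle⟩ := hh.integral_sqrt_le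
  have hS := pathPlanarSup_nonneg ω
  refine le_trans ?_ (mul_le_mul_of_nonneg_left hle (by positivity))
  rw [riemLength, ← intervalIntegral.integral_const_mul,
    intervalIntegral.integral_of_le zero_le_one, intervalIntegral.integral_of_le zero_le_one]
  refine integral_mono_of_nonneg (.of_forall fun _ => Real.sqrt_nonneg _) (hI.const_mul _) ?_
  have hd := (intervalIntegrable_bridgeVelocity (ε := ε) (ω := ω) hh).ae_hasDerivAt_integral
  rw [EventuallyLE, ae_restrict_iff' measurableSet_Ioc]
  filter_upwards [hd] with s hs hs01
  have hs' : s ∈ Icc (0 : ℝ) 1 := Ioc_subset_Icc_self hs01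
  have d₂ := (hs (by rwa [uIcc_of_le zero_le_one]) 0 left_mem_uIcc).deriv
  have e₀ : deriv (fun r => bridge ε h ω r 0) s = deriv (fun r => h r 0) s := by
    simp [bridge]
  have e₁ : deriv (fun r => bridge ε h ω r 1) s = deriv (fun r => h r 1) s := by
    simp [bridge]
  have e₂ : deriv (fun r => bridge ε h ω r 2) s = bridgeVelocity ε h ω s := by
    simp [bridge, d₂]
  have b := sqrt_sq_add_cross_le (x := deriv (fun r => h r 0) s) (y := deriv (fun r => h r 1) s)
    (z := deriv (fun r => h r 2) s) (inv_nonneg.2 hε.le) hS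
    (sqrt_le_pathPlanarSup ω (projIcc 0 1 zero_le_one s)) (sqrt_le_pathPlanarSup ω 1)
  simp only [Fin.sum_univ_three, frameCoeff, Matrix.cons_val_zero, Matrix.cons_val_one,
    Matrix.cons_val, e₀, e₁, e₂]
  refine le_of_eq_of_le ?_ b
  congr 3
  simp only [bridge, bridgeVelocity, pathCoord, ContinuousMap.coe_mk, Matrix.cons_val_zero,
    Matrix.cons_val_one]
  field_simp
  ring

/-- The endpoint map is Lipschitz along Cameron-Martin directions, with a constant that depends
on the path. -/
lemma riemDist_le_mul_cameronMartinCost (hε : 0 < ε) (ω η : PathSpace) :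
    ENNReal.ofReal (riemDist ε (ω.1 1) (η.1 1)) ≤
      ENNReal.ofReal (1 + 2 * ε⁻¹ * pathPlanarSup ω) * cameronMartinCost ε ω η := by
  have hS := pathPlanarSup_nonneg ω
  have hK : 0 < 1 + 2 * ε⁻¹ * pathPlanarSup ω := by positivity
  rw [mul_comm, ← ENNReal.div_le_iff (by simpa using hK) ENNReal.ofReal_ne_top]
  refine le_iInf₂ fun h ⟨hh, H⟩ => ?_
  rw [ENNReal.div_le_iff (by simpa using hK) ENNReal.ofReal_ne_top, mul_comm,
    ← ENNReal.ofReal_mul hK.le]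
  exact ENNReal.ofReal_le_ofReal ((riemDist_le_riemLength
    (absolutelyContinuousOnInterval_bridge hh) (bridge_zero hh) (bridge_one hh H)).trans
    (riemLength_bridge_le hε hh))

end Shift

/-! ### Moments of the supremum of Brownian motion -/

lemma enorm_dyadic_le_sum {f : ℝ → ℝ} (h0 : f 0 = 0) {D : ℕ → ℝ≥0∞}
    (hD : ∀ m k : ℕ, k < 2 ^ m → ‖f ((k + 1 : ℕ) / 2 ^ m) - f (k / 2 ^ m)‖ₑ ≤ D m) :
    ∀ n k : ℕ, k ≤ 2 ^ n → ‖f (k / 2 ^ n)‖ₑ ≤ ∑ m ∈ Finset.range (n + 1), D m := by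
  intro n
  induction n with
  | zero =>
    intro k hk
    have hk' : k ≤ 1 := by simpa using hk
    interval_cases k
    · simp [h0]
    · simpa [h0] using hD 0 0 one_pos
  | succ n ih =>
    intro k hk
    have half (j : ℕ) : ((2 * j : ℕ) : ℝ) / 2 ^ (n + 1) = j / 2 ^ n := by
      push_cast
      field_simp
      ring
    rw [Finset.sum_range_succ]
    obtain ⟨j, rfl | rfl⟩ : ∃ j, k = 2 * j ∨ k = 2 * j + 1 := ⟨k / 2, by omega⟩
    · rw [half]
      exact (ih j (by rw [pow_succ] at hk; omega)).trans le_self_add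
    · have h1 := hD (n + 1) (2 * j) (by omega)
      rw [half] at h1
      calc ‖f ((2 * j + 1 : ℕ) / 2 ^ (n + 1))‖ₑ
          = ‖f (j / 2 ^ n) + (f ((2 * j + 1 : ℕ) / 2 ^ (n + 1)) - f (j / 2 ^ n))‖ₑ := by
            rw [add_sub_cancel]
        _ ≤ _ := (enorm_add_le _ _).trans
            (add_le_add (ih j (by rw [pow_succ] at hk; omega)) h1)

/-- The chaining bound: a continuous function on `[0, 1]` that vanishes at `0` is controlled by its
increments over the dyadic intervals. -/
lemma enorm_le_tsum_dyadic {f : ℝ → ℝ} (hf : Continuous f) (h0 : f 0 = 0) {D : ℕ → ℝ≥0∞}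
    (hD : ∀ m k : ℕ, k < 2 ^ m → ‖f ((k + 1 : ℕ) / 2 ^ m) - f (k / 2 ^ m)‖ₑ ≤ D m)
    {t : ℝ} (ht : t ∈ Icc (0 : ℝ) 1) : ‖f t‖ₑ ≤ ∑' m, D m := by
  have h1 : Tendsto (fun n : ℕ => ((⌊t * 2 ^ n⌋₊ : ℕ) : ℝ) / 2 ^ n) atTop (𝓝 t) :=
    (tendsto_nat_floor_mul_div_atTop ht.1).comp
      (tendsto_pow_atTop_atTop_of_one_lt (one_lt_two : (1 : ℝ) < 2))
  have h2 := ((continuous_enorm.comp hf).tendsto t).comp h1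
  refine le_of_tendsto' h2 fun n => ?_
  refine (enorm_dyadic_le_sum h0 hD n _ ?_).trans (ENNReal.sum_le_tsum _)
  refine Nat.floor_le_of_le ?_
  push_cast
  exact mul_le_of_le_one_left (by positivity) ht.2

/-- The sum over all dyadic subintervals of `[0, 1]` of the `r`-th powers of the increments of `f`,
weighted by `2 ^ (m r / 4)` at the level `m`. -/
noncomputable def dyadicEnergy (r : ℝ) (f : ℝ → ℝ) : ℝ≥0∞ :=
  ∑' m : ℕ, ∑ k ∈ Finset.range (2 ^ m),
    (2 ^ (r / 4) : ℝ≥0∞) ^ m * ‖f ((k + 1 : ℕ) / 2 ^ m) - f (k / 2 ^ m)‖ₑ ^ r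

/-- The constant of the bound `sup |f| ≤ C (dyadicEnergy r f)^(1/r)`: the sum of the geometric
series of ratio `2 ^ (-1/4)`. -/
noncomputable def chainingConst : ℝ≥0∞ := (1 - (2 ^ (1 / 4 : ℝ))⁻¹)⁻¹

lemma chainingConst_ne_top : chainingConst ≠ ∞ := by
  have : ((2 : ℝ≥0∞) ^ (1 / 4 : ℝ))⁻¹ < 1 :=
    ENNReal.inv_lt_one.2 (ENNReal.one_lt_rpow (by norm_num) (by norm_num))
  exact ENNReal.inv_ne_top.2 (tsub_pos_of_lt this).ne'

lemma enorm_le_dyadicEnergy {r : ℝ} (hr : 0 < r) {f : ℝ → ℝ} (hf : Continuous f) (h0 : f 0 = 0)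
    {t : ℝ} (ht : t ∈ Icc (0 : ℝ) 1) :
    ‖f t‖ₑ ≤ chainingConst * dyadicEnergy r f ^ (1 / r) := by
  refine (enorm_le_tsum_dyadic hf h0
    (D := fun m => ((2 ^ (1 / 4 : ℝ))⁻¹) ^ m * dyadicEnergy r f ^ (1 / r)) ?_ ht).trans_eq ?_
  · intro m k hk
    set x := ‖f ((k + 1 : ℕ) / 2 ^ m) - f (k / 2 ^ m)‖ₑ
    have hw : ((2 : ℝ≥0∞) ^ (1 / 4 : ℝ)) ^ r = 2 ^ (r / 4) := by
      rw [← ENNReal.rpow_mul]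
      ring_nf
    have h1 : (((2 : ℝ≥0∞) ^ (1 / 4 : ℝ)) ^ m * x) ^ r ≤ dyadicEnergy r f := by
      rw [ENNReal.mul_rpow_of_nonneg _ _ hr.le, ← ENNReal.rpow_natCast, ← ENNReal.rpow_mul,
        mul_comm (m : ℝ), ENNReal.rpow_mul, hw, ENNReal.rpow_natCast]
      refine le_trans ?_ (ENNReal.le_tsum m)
      exact Finset.single_le_sum (f := fun k : ℕ => (2 ^ (r / 4) : ℝ≥0∞) ^ m *
        ‖f ((k + 1 : ℕ) / 2 ^ m) - f (k / 2 ^ m)‖ₑ ^ r) (fun _ _ => zero_le)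
        (Finset.mem_range.2 hk)
    have h2 := (ENNReal.le_rpow_inv_iff hr).2 h1
    have hne : ((2 : ℝ≥0∞) ^ (1 / 4 : ℝ)) ^ m ≠ 0 := by simp
    have hnt : ((2 : ℝ≥0∞) ^ (1 / 4 : ℝ)) ^ m ≠ ∞ := by simp
    rw [← ENNReal.inv_pow, mul_comm, ← div_eq_mul_inv, ENNReal.le_div_iff_mul_le (.inl hne)
      (.inl hnt), mul_comm]
    rwa [one_div r]
  · rw [ENNReal.tsum_mul_right, ENNReal.tsum_geometric, chainingConst]

lemma lintegral_rpow_gaussianReal (v : ℝ≥0) {r : ℝ} (hr : 0 ≤ r) :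
    ∫⁻ x, ‖x‖ₑ ^ r ∂(gaussianReal 0 v) =
      (v : ℝ≥0∞) ^ (r / 2) * ∫⁻ x, ‖x‖ₑ ^ r ∂(gaussianReal 0 1) := by
  have h : gaussianReal 0 v = (gaussianReal 0 1).map (fun x => √v * x) := by
    rw [gaussianReal_map_const_mul, mul_zero]
    congr 1
    ext
    simp
  have hv : ‖√(v : ℝ)‖ₑ = (v : ℝ≥0∞) ^ (1 / 2 : ℝ) := by
    rw [Real.enorm_of_nonneg (Real.sqrt_nonneg _), Real.sqrt_eq_rpow,
      ← ENNReal.ofReal_rpow_of_nonneg v.coe_nonneg (by norm_num), ENNReal.ofReal_coe_nnreal]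
  rw [h, lintegral_map (by fun_prop) (by fun_prop), ← lintegral_const_mul _ (by fun_prop)]
  refine lintegral_congr fun x => ?_
  rw [enorm_mul, ENNReal.mul_rpow_of_nonneg _ _ hr, hv, ← ENNReal.rpow_mul]
  ring_nf

lemma lintegral_rpow_gaussianReal_lt_top {r : ℝ} (hr : 0 < r) :
    ∫⁻ x, ‖x‖ₑ ^ r ∂(gaussianReal 0 1) < ∞ := by
  have h := (memLp_id_gaussianReal' (μ := 0) (v := 1) (ENNReal.ofReal r)
    ENNReal.ofReal_ne_top).2
  rw [eLpNorm_lt_top_iff_lintegral_rpow_enorm_lt_top (by simpa using hr) ENNReal.ofReal_ne_top,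
    ENNReal.toReal_ofReal hr.le] at h
  exact h

section Brownian

variable {Ω : Type*} [MeasurableSpace Ω] {P : Measure Ω}

lemma ProbabilityTheory.IsBrownianReal.aemeasurable_dyadicEnergy {W : ℝ≥0 → Ω → ℝ}
    (hW : IsBrownianReal W P) (r : ℝ) :
    AEMeasurable (fun ω => dyadicEnergy r fun t => W t.toNNReal ω) P := by
  have := fun t => hW.aemeasurable t
  unfold dyadicEnergy
  fun_prop

lemma ProbabilityTheory.IsBrownianReal.lintegral_dyadicEnergy_lt_top {W : ℝ≥0 → Ω → ℝ}
    (hW : IsBrownianReal W P) {r : ℝ} (hr : 8 ≤ r) :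
    ∫⁻ ω, dyadicEnergy r (fun t => W t.toNNReal ω) ∂P < ∞ := by
  have hm := fun t => hW.aemeasurable t
  set M := ∫⁻ x, ‖x‖ₑ ^ r ∂(gaussianReal 0 1) with hM
  have hMt : M < ∞ := lintegral_rpow_gaussianReal_lt_top (by linarith)
  have hinc (m k : ℕ) : ∫⁻ ω, ‖W (((k + 1 : ℕ) : ℝ) / 2 ^ m).toNNReal ω -
      W ((k : ℝ) / 2 ^ m).toNNReal ω‖ₑ ^ r ∂P = ((2 : ℝ≥0∞)⁻¹ ^ (r / 2)) ^ m * M := by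
    have hl := hW.hasLaw_sub (((k + 1 : ℕ) : ℝ) / 2 ^ m).toNNReal ((k : ℝ) / 2 ^ m).toNNReal
    have hv : nndist (((k + 1 : ℕ) : ℝ) / 2 ^ m).toNNReal.1 ((k : ℝ) / 2 ^ m).toNNReal.1 =
        (2⁻¹ : ℝ≥0) ^ m := by
      ext
      change |((((k + 1 : ℕ) : ℝ) / 2 ^ m).toNNReal : ℝ) - (((k : ℝ) / 2 ^ m).toNNReal : ℝ)| = _
      rw [Real.coe_toNNReal _ (by positivity), Real.coe_toNNReal _ (by positivity), ← sub_div,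
        abs_of_nonneg (by push_cast; simp)]
      push_cast
      simp
    rw [hv] at hl
    have := hl.lintegral_comp (f := fun x => ‖x‖ₑ ^ r) (by fun_prop)
    simp only [Pi.sub_apply] at this
    rw [this, lintegral_rpow_gaussianReal _ (by linarith), ← hM]
    congr 1
    push_cast
    rw [← ENNReal.rpow_natCast, ← ENNReal.rpow_natCast,
      ← ENNReal.rpow_mul, ← ENNReal.rpow_mul, mul_comm]
  unfold dyadicEnergy
  rw [lintegral_tsum (by fun_prop)]
  have hterm (m : ℕ) : ∫⁻ ω, ∑ k ∈ Finset.range (2 ^ m), (2 ^ (r / 4) : ℝ≥0∞) ^ m *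
      ‖W (((k + 1 : ℕ) : ℝ) / 2 ^ m).toNNReal ω - W ((k : ℝ) / 2 ^ m).toNNReal ω‖ₑ ^ r ∂P =
      (2 * 2 ^ (r / 4) * 2⁻¹ ^ (r / 2)) ^ m * M := by
    rw [lintegral_finsetSum' _ (by fun_prop)]
    simp_rw [lintegral_const_mul' _ _ (ENNReal.pow_ne_top (by simp) :
      ((2 : ℝ≥0∞) ^ (r / 4)) ^ m ≠ ∞), hinc]
    rw [Finset.sum_const, Finset.card_range, nsmul_eq_mul]
    push_cast
    ring
  simp_rw [hterm]
  rw [ENNReal.tsum_mul_right, ENNReal.tsum_geometric]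
  refine ENNReal.mul_lt_top ?_ hMt
  -- The ratio of the geometric series is `2 ^ (1 - r / 4)`.
  have hρ : (2 : ℝ≥0∞) * 2 ^ (r / 4) * 2⁻¹ ^ (r / 2) < 1 := by
    rw [ENNReal.inv_rpow, ← ENNReal.rpow_neg]
    nth_rewrite 1 [← ENNReal.rpow_one 2]
    rw [← ENNReal.rpow_add _ _ (by simp) (by simp), ← ENNReal.rpow_add _ _ (by simp) (by simp)]
    exact ENNReal.rpow_lt_one_of_one_lt_of_neg (by norm_num) (by linarith)
  simpa [ENNReal.inv_lt_top] using hρ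

lemma ciSup_eq_ciSup_denseSeq {F : unitInterval → ℝ} (hF : Continuous F) :
    ⨆ t, F t = ⨆ n, F (TopologicalSpace.denseSeq unitInterval n) := by
  have hb : BddAbove (range F) := (isCompact_range hF).bddAbove
  have hb' : BddAbove (range fun n => F (TopologicalSpace.denseSeq unitInterval n)) :=
    hb.mono (by rintro _ ⟨n, rfl⟩; exact mem_range_self _)
  refine le_antisymm (ciSup_le fun t => ?_) (ciSup_le fun n => le_ciSup hb _)
  have hc : IsClosed {t | F t ≤ ⨆ n, F (TopologicalSpace.denseSeq unitInterval n)} :=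
    isClosed_le hF continuous_const
  exact (TopologicalSpace.denseRange_denseSeq unitInterval).induction_on t hc
    fun n => le_ciSup hb' n

variable {B : Fin 3 → ℝ≥0 → Ω → ℝ}

lemma continuous_toNNReal_unitInterval : Continuous unitInterval.toNNReal :=
  continuous_induced_rng.2 continuous_subtype_val

lemma IsBrownianThree.ae_continuous (hB : IsBrownianThree B P) (i : Fin 3) :
    ∀ᵐ ω ∂P, Continuous fun t : unitInterval => B i (unitInterval.toNNReal t) ω := by
  filter_upwards [(hB.1 i).cont] with ω hω using hω.comp continuous_toNNReal_unitInterval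

lemma IsBrownianThree.aemeasurable_planarSup (hB : IsBrownianThree B P) :
    AEMeasurable (planarSup B) P := by
  have hm := fun i t => (hB.1 i).aemeasurable t
  have h : AEMeasurable (fun ω => ⨆ n : ℕ,
      √(B 0 (unitInterval.toNNReal (TopologicalSpace.denseSeq unitInterval n)) ω ^ 2 +
        B 1 (unitInterval.toNNReal (TopologicalSpace.denseSeq unitInterval n)) ω ^ 2)) P := by
    fun_prop
  refine h.congr ?_
  filter_upwards [hB.ae_continuous 0, hB.ae_continuous 1] with ω h₀ h₁
  exact (ciSup_eq_ciSup_denseSeq (F := fun t => √(B 0 (unitInterval.toNNReal t) ω ^ 2 +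
    B 1 (unitInterval.toNNReal t) ω ^ 2)) ((h₀.pow 2).add (h₁.pow 2)).sqrt).symm

lemma planarSup_nonneg {Ω : Type*} [MeasurableSpace Ω] (B : Fin 3 → ℝ≥0 → Ω → ℝ) (ω : Ω) :
    0 ≤ planarSup B ω :=
  Real.iSup_nonneg fun _ => Real.sqrt_nonneg _

lemma enorm_planarSup_le {x : Fin 2 → ℝ≥0∞} {ω : Ω}
    (h₀ : ∀ t : unitInterval, ‖B 0 (unitInterval.toNNReal t) ω‖ₑ ≤ x 0)
    (h₁ : ∀ t : unitInterval, ‖B 1 (unitInterval.toNNReal t) ω‖ₑ ≤ x 1) :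
    ‖planarSup B ω‖ₑ ≤ x 0 + x 1 := by
  rcases eq_or_ne (x 0 + x 1) ∞ with ht | ht
  · simp [ht]
  rw [Real.enorm_of_nonneg (planarSup_nonneg B ω), ENNReal.ofReal_le_iff_le_toReal ht]
  refine ciSup_le fun t => ?_
  have h := add_le_add (h₀ t) (h₁ t)
  rw [← ofReal_norm, ← ofReal_norm, ← ENNReal.ofReal_add (norm_nonneg _) (norm_nonneg _),
    ENNReal.ofReal_le_iff_le_toReal ht] at h
  refine le_trans (Real.sqrt_le_iff.2 ⟨by positivity, ?_⟩) h
  rw [add_sq, Real.norm_eq_abs, Real.norm_eq_abs, sq_abs, sq_abs]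
  nlinarith [mul_nonneg (abs_nonneg (B 0 (unitInterval.toNNReal t) ω))
    (abs_nonneg (B 1 (unitInterval.toNNReal t) ω))]

/-- The supremum of planar Brownian motion over `[0, 1]` has moments of all orders. -/
lemma IsBrownianThree.memLp_planarSup [IsProbabilityMeasure P] (hB : IsBrownianThree B P)
    {q : ℝ≥0∞} (hq : q ≠ ∞) : MemLp (planarSup B) q P := by
  -- For `r ≥ 8` the expected energies of the dyadic levels are summable.
  set r : ℝ := max 8 q.toReal
  have hr8 : 8 ≤ r := le_max_left _ _
  have hr : 0 < r := by linarith
  have hqr : q ≤ ENNReal.ofReal r := by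
    rw [← ENNReal.ofReal_toReal hq]
    exact ENNReal.ofReal_le_ofReal (le_max_right _ _)
  refine MemLp.mono_exponent ⟨hB.aemeasurable_planarSup.aestronglyMeasurable, ?_⟩ hqr
  let S (i : Fin 3) (ω : Ω) : ℝ≥0∞ :=
    chainingConst * dyadicEnergy r (fun t => B i t.toNNReal ω) ^ (1 / r)
  have hSm i : AEMeasurable (S i) P :=
    (((hB.1 i).aemeasurable_dyadicEnergy r).pow_const _).const_mul _
  have hS i : eLpNorm (S i) (ENNReal.ofReal r) P < ∞ := by
    rw [eLpNorm_lt_top_iff_lintegral_rpow_enorm_lt_top (by simpa using hr) ENNReal.ofReal_ne_top,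
      ENNReal.toReal_ofReal hr.le]
    simp only [S, enorm_eq_self, ENNReal.mul_rpow_of_nonneg _ _ hr.le, ← ENNReal.rpow_mul,
      one_div_mul_cancel hr.ne', ENNReal.rpow_one]
    have hc : chainingConst ^ r ≠ ∞ := ENNReal.rpow_ne_top_of_nonneg hr.le chainingConst_ne_top
    rw [lintegral_const_mul' _ _ hc]
    exact ENNReal.mul_lt_top hc.lt_top ((hB.1 i).lintegral_dyadicEnergy_lt_top hr8)
  have hbound (i : Fin 3) : ∀ᵐ ω ∂P, ∀ t : unitInterval,
      ‖B i (unitInterval.toNNReal t) ω‖ₑ ≤ S i ω := by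
    filter_upwards [(hB.1 i).cont, (hB.1 i).eval_zero_ae_eq_zero] with ω hc h0 t
    have := enorm_le_dyadicEnergy hr (hc.comp continuous_real_toNNReal) (by simpa using h0) t.2
    rwa [Function.comp_apply, Real.toNNReal_of_nonneg t.2.1] at this
  have hle : eLpNorm (planarSup B) (ENNReal.ofReal r) P ≤
      eLpNorm (S 0 + S 1) (ENNReal.ofReal r) P := by
    refine eLpNorm_mono_enorm_ae ?_
    filter_upwards [hbound 0, hbound 1] with ω h₀ h₁
    exact enorm_planarSup_le (x := ![S 0 ω, S 1 ω]) h₀ h₁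
  refine hle.trans_lt ((eLpNorm_add_le (hSm 0).aestronglyMeasurable
    (hSm 1).aestronglyMeasurable ?_).trans_lt (ENNReal.add_lt_top.2 ⟨hS 0, hS 1⟩))
  exact ENNReal.one_le_ofReal.2 (by linarith)

lemma IsBrownianThree.eLpNorm_planarSup_pos [IsProbabilityMeasure P] (hB : IsBrownianThree B P)
    {q : ℝ≥0∞} (hq0 : q ≠ 0) (hq : q ≠ ∞) : 0 < (eLpNorm (planarSup B) q P).toReal := by
  refine ENNReal.toReal_pos (fun h => ?_) (hB.memLp_planarSup hq).2.ne
  rw [eLpNorm_eq_zero_iff hB.aemeasurable_planarSup.aestronglyMeasurable hq0] at h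
  have h0 : ∀ᵐ ω ∂P, B 0 1 ω = 0 := by
    filter_upwards [h, hB.ae_continuous 0, hB.ae_continuous 1] with ω hω h₀ h₁
    have hb := le_ciSup (f := fun t => √(B 0 (unitInterval.toNNReal t) ω ^ 2 +
      B 1 (unitInterval.toNNReal t) ω ^ 2))
      (isCompact_range ((h₀.pow 2).add (h₁.pow 2)).sqrt).bddAbove 1
    have hz : √(B 0 (unitInterval.toNNReal 1) ω ^ 2 +
      B 1 (unitInterval.toNNReal 1) ω ^ 2) ≤ 0 := hb.trans_eq hω
    have h1 : unitInterval.toNNReal 1 = 1 := rfl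
    rw [h1] at hz
    have := Real.sqrt_eq_zero'.1 (le_antisymm hz (Real.sqrt_nonneg _))
    nlinarith [sq_nonneg (B 0 1 ω), sq_nonneg (B 1 1 ω)]
  have hl := (hB.1 0).hasLaw_eval 1
  have := nullSingletonClass_gaussianReal (μ := 0) (one_ne_zero (α := ℝ≥0))
  have h2 := (ae_map_iff (p := fun x => x = 0) hl.aemeasurable (measurableSet_singleton 0)).2 h0
  rw [hl.map_eq] at h2
  have h3 : ∀ᵐ x ∂(gaussianReal 0 1), x ≠ 0 := by simp [ae_iff, measure_singleton]
  obtain ⟨x, hx, hx'⟩ := (h2.and h3).exists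
  exact hx' hx

/-! ### The planar part of Brownian motion on `M_ε` -/

lemma gridPoint_zero (t : unitInterval) (n : ℕ) : gridPoint t n 0 = 0 := by
  simp [gridPoint]

lemma gridPoint_self (t : unitInterval) {n : ℕ} (hn : n ≠ 0) : gridPoint t n n = t := by
  have : (n : ℝ) / n = 1 := div_self (by exact_mod_cast hn)
  simp [gridPoint, this]

lemma TendstoInMeasure.apply_pi {κ : Type*} [Fintype κ] {F : ℕ → Ω → κ → ℝ} {f : Ω → κ → ℝ}
    (h : TendstoInMeasure P F atTop f) (i : κ) :
    TendstoInMeasure P (fun n ω => F n ω i) atTop (fun ω => f ω i) := by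
  intro δ hδ
  refine tendsto_of_tendsto_of_tendsto_of_le_of_le tendsto_const_nhds (h δ hδ)
    (fun _ => zero_le) (fun n => measure_mono fun ω hω => ?_)
  exact le_trans hω (edist_le_pi_edist _ _ i)

/-- The Itô integral of a constant is the increment of the integrator: the Riemann sums
telescope. -/
lemma IsItoIntegral.ae_eq_of_const {X : unitInterval → Ω → Heis} {W : ℝ≥0 → Ω → ℝ}
    {J : unitInterval → Ω → Heis} (hJ : IsItoIntegral P X W J) {i : Fin 3} {c : ℝ}
    (hX : ∀ t ω, X t ω i = c) (t : unitInterval) :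
    ∀ᵐ ω ∂P, J t ω i = (W (unitInterval.toNNReal t) ω - W 0 ω) * c := by
  have h := TendstoInMeasure.apply_pi (hJ t) i
  refine tendstoInMeasure_ae_unique h (?_ : TendstoInMeasure P _ atTop _)
  intro δ hδ
  refine tendsto_const_nhds.congr' ?_
  filter_upwards [eventually_ne_atTop 0] with n hn
  have hsum ω : (∑ k ∈ Finset.range n, (W (unitInterval.toNNReal (gridPoint t n (k + 1))) ω -
      W (unitInterval.toNNReal (gridPoint t n k)) ω) • X (gridPoint t n k) ω) i =
      (W (unitInterval.toNNReal t) ω - W 0 ω) * c := by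
    simp only [Finset.sum_apply, Pi.smul_apply, hX, smul_eq_mul]
    rw [← Finset.sum_mul, Finset.sum_range_sub
      (fun k => W (unitInterval.toNNReal (gridPoint t n k)) ω), gridPoint_self t hn,
      gridPoint_zero]
    rfl
  simp [hsum, hδ.ne']

/-- The planar part of the solution of the stochastic differential equation is the planar part of
the driving Brownian motion, simultaneously at all times. -/
lemma IsRiemBrownian.ae_planar {ε : ℝ} {Bb : Ω → PathSpace} (h : IsRiemBrownian ε B Bb P)
    (hB : IsBrownianThree B P) :
    ∀ᵐ ω ∂P, ∀ t : unitInterval, (Bb ω).1 t 0 = B 0 (unitInterval.toNNReal t) ω ∧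
      (Bb ω).1 t 1 = B 1 (unitInterval.toNNReal t) ω := by
  obtain ⟨-, J, hJ, hsum⟩ := h
  have pt (t : unitInterval) : ∀ᵐ ω ∂P, (Bb ω).1 t 0 = B 0 (unitInterval.toNNReal t) ω ∧
      (Bb ω).1 t 1 = B 1 (unitInterval.toNNReal t) ω := by
    filter_upwards [hsum t, (hB.1 0).eval_zero_ae_eq_zero, (hB.1 1).eval_zero_ae_eq_zero,
      (hJ 0).ae_eq_of_const (i := 0) (c := 1) (fun t ω => by simp [frame]) t,
      (hJ 1).ae_eq_of_const (i := 0) (c := 0) (fun t ω => by simp [frame]) t,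
      (hJ 2).ae_eq_of_const (i := 0) (c := 0) (fun t ω => by simp [frame]) t,
      (hJ 0).ae_eq_of_const (i := 1) (c := 0) (fun t ω => by simp [frame]) t,
      (hJ 1).ae_eq_of_const (i := 1) (c := 1) (fun t ω => by simp [frame]) t,
      (hJ 2).ae_eq_of_const (i := 1) (c := 0) (fun t ω => by simp [frame]) t]
      with ω hs z₀ z₁ h₀₀ h₁₀ h₂₀ h₀₁ h₁₁ h₂₁
    rw [hs]
    simp [Fin.sum_univ_three, h₀₀, h₁₀, h₂₀, h₀₁, h₁₁, h₂₁, z₀, z₁]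
  have hd := ae_all_iff.2 fun n => pt (TopologicalSpace.denseSeq unitInterval n)
  filter_upwards [hd, hB.ae_continuous 0, hB.ae_continuous 1] with ω hω c₀ c₁ t
  refine (TopologicalSpace.denseRange_denseSeq unitInterval).induction_on t ?_ hω
  exact (isClosed_eq (by fun_prop) c₀).inter (isClosed_eq (by fun_prop) c₁)

lemma IsRiemBrownian.ae_pathPlanarSup {ε : ℝ} {Bb : Ω → PathSpace}
    (h : IsRiemBrownian ε B Bb P) (hB : IsBrownianThree B P) :
    ∀ᵐ ω ∂P, pathPlanarSup (Bb ω) = planarSup B ω := by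
  filter_upwards [h.ae_planar hB] with ω hω
  simp only [pathPlanarSup, planarSup, hω]

lemma measurable_pathSpace_apply (t : unitInterval) :
    Measurable fun ω : PathSpace => ω.1 t :=
  (continuous_eval_const (F := C(unitInterval, Heis)) t).measurable.comp measurable_subtype_coe

lemma measurable_pathPlanarSup : Measurable pathPlanarSup := by
  have h : pathPlanarSup = fun ω => ⨆ n : ℕ,
      √(ω.1 (TopologicalSpace.denseSeq unitInterval n) 0 ^ 2 +
        ω.1 (TopologicalSpace.denseSeq unitInterval n) 1 ^ 2) :=
    funext fun ω => ciSup_eq_ciSup_denseSeq (F := fun t => √(ω.1 t 0 ^ 2 + ω.1 t 1 ^ 2))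
      (by fun_prop)
  have hm (t : unitInterval) (i : Fin 3) : Measurable fun ω : PathSpace => ω.1 t i :=
    (measurable_pi_apply i).comp (measurable_pathSpace_apply t)
  rw [h]
  exact Measurable.iSup fun n => (((hm _ 0).pow_const 2).add ((hm _ 1).pow_const 2)).sqrt

/-- The Lipschitz constant of the endpoint map has the `L^q` norm that appears in `projConst`. -/
lemma lintegral_endpoint_lipschitz_le [IsProbabilityMeasure P] (hB : IsBrownianThree B P)
    {ε : ℝ} (hε : 0 < ε) {Bb : Ω → PathSpace} (h : IsRiemBrownian ε B Bb P) {q : ℝ}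
    (hq : 1 ≤ q) :
    (∫⁻ ω, ENNReal.ofReal (1 + 2 * ε⁻¹ * pathPlanarSup ω) ^ q ∂(P.map Bb)) ^ (1 / q) ≤
      ENNReal.ofReal (1 + 2 * ε⁻¹ * (eLpNorm (planarSup B) (ENNReal.ofReal q) P).toReal) := by
  have hq0 : 0 < q := by linarith
  have hq0' : ENNReal.ofReal q ≠ 0 := by simpa using hq0
  have hmem := hB.memLp_planarSup (ENNReal.ofReal_ne_top (r := q))
  have hm : Measurable fun ω => ENNReal.ofReal (1 + 2 * ε⁻¹ * pathPlanarSup ω) ^ q := by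
    have := measurable_pathPlanarSup
    fun_prop
  calc (∫⁻ ω, ENNReal.ofReal (1 + 2 * ε⁻¹ * pathPlanarSup ω) ^ q ∂(P.map Bb)) ^ (1 / q)
      = eLpNorm ((fun _ : Ω => (1 : ℝ)) + (2 * ε⁻¹) • planarSup B) (ENNReal.ofReal q) P := by
        rw [lintegral_map' hm.aemeasurable h.1,
          eLpNorm_eq_lintegral_rpow_enorm_toReal hq0' ENNReal.ofReal_ne_top,
          ENNReal.toReal_ofReal hq0.le]
        congr 1
        refine lintegral_congr_ae ?_
        filter_upwards [h.ae_pathPlanarSup hB] with ω hω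
        have := planarSup_nonneg B ω
        rw [hω, Pi.add_apply, Pi.smul_apply, smul_eq_mul,
          Real.enorm_of_nonneg (by positivity)]
    _ ≤ eLpNorm (fun _ : Ω => (1 : ℝ)) (ENNReal.ofReal q) P +
          eLpNorm ((2 * ε⁻¹) • planarSup B) (ENNReal.ofReal q) P :=
        eLpNorm_add_le aestronglyMeasurable_const (hmem.1.const_smul _)
          (ENNReal.one_le_ofReal.2 hq)
    _ = _ := by
        rw [eLpNorm_const _ hq0' (NeZero.ne P), eLpNorm_const_smul,
          Real.enorm_of_nonneg (by positivity : 0 ≤ 2 * ε⁻¹),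
          ENNReal.ofReal_add zero_le_one (by positivity),
          ENNReal.ofReal_mul (p := 2 * ε⁻¹) (by positivity),
          ENNReal.ofReal_toReal hmem.2.ne]
        simp

end Brownian

/-! ### Pushing transport inequalities forward -/

section Pushforward

variable {E F : Type*} [MeasurableSpace E] [MeasurableSpace F] {μ : Measure E} {e : E → F}

/-- A measure that is absolutely continuous with respect to an image measure `μ ∘ e⁻¹` lifts to
a measure with the same relative entropy: pull its density back along `e`. -/
lemma exists_map_eq_klDiv_eq [IsProbabilityMeasure μ] (he : Measurable e) {ν : Measure F}
    [IsProbabilityMeasure ν] (hν : ν ≪ μ.map e) :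
    ∃ ρ : Measure E, IsProbabilityMeasure ρ ∧ ρ.map e = ν ∧
      InformationTheory.klDiv ρ μ = InformationTheory.klDiv ν (μ.map e) := by
  have : IsProbabilityMeasure (μ.map e) := Measure.isProbabilityMeasure_map he.aemeasurable
  set f := ν.rnDeriv (μ.map e)
  have hf : Measurable f := Measure.measurable_rnDeriv _ _
  have hmap : (μ.withDensity (f ∘ e)).map e = ν := by
    conv_rhs => rw [← Measure.withDensity_rnDeriv_eq ν (μ.map e) hν]
    ext s hs
    rw [Measure.map_apply he hs, withDensity_apply _ (he hs), withDensity_apply _ hs,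
      setLIntegral_map hs hf he]
    rfl
  have hprob : IsProbabilityMeasure (μ.withDensity (f ∘ e)) := by
    rw [← Measure.isProbabilityMeasure_map_iff he.aemeasurable, hmap]
    infer_instance
  refine ⟨_, hprob, hmap, ?_⟩
  rw [InformationTheory.klDiv_eq_lintegral_klFun, InformationTheory.klDiv_eq_lintegral_klFun,
    if_pos (withDensity_absolutelyContinuous _ _), if_pos hν, lintegral_map (by fun_prop) he]
  refine lintegral_congr_ae ?_
  filter_upwards [Measure.rnDeriv_withDensity μ (hf.comp he)] with x hx
  rw [hx]
  rfl

/-- Transport costs under a map that is Lipschitz with a constant `K x` depending on the first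
point. The costs `c` and `d` need not be measurable: Hölder's inequality is applied to a measurable
minorant of `d` with the same integral. -/
lemma transportCost_map_le (he : Measurable e) {c : E → E → ℝ≥0∞} {d : F → F → ℝ≥0∞}
    {K : E → ℝ≥0∞} (hK : Measurable K) (hK0 : ∀ x, K x ≠ 0) (hKt : ∀ x, K x ≠ ∞)
    (hd : ∀ x y, d (e x) (e y) ≤ K x * c x y) {p q : ℝ} (hp : 0 < p) (hp2 : p < 2)
    (hpq : 1 / p = 1 / q + 1 / 2) {M : ℝ≥0∞} (hM0 : M ≠ 0) (hMt : M ≠ ∞)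
    (hKM : (∫⁻ x, K x ^ q ∂μ) ^ (1 / q) ≤ M) (ρ : Measure E) :
    transportCost d p (μ.map e) (ρ.map e) ≤ M * transportCost c 2 μ ρ := by
  have hq0 : 0 < 1 / q := by
    have := one_div_lt_one_div_of_lt hp hp2
    linarith
  have hpq' : p < q := by
    rw [← one_div_lt_one_div (one_div_pos.1 hq0) hp]
    linarith
  rw [mul_comm, ← ENNReal.div_le_iff hM0 hMt]
  conv_rhs => rw [transportCost, one_div]
  rw [ENNReal.le_rpow_inv_iff two_pos]
  refine le_iInf₂ fun π hπ => ?_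
  rw [← ENNReal.le_rpow_inv_iff two_pos, ENNReal.div_le_iff hM0 hMt, mul_comm]
  have hpair : Measurable (Prod.map e e) := he.prodMap he
  have hcoup : (π.map (Prod.map e e)).map Prod.fst = μ.map e ∧
      (π.map (Prod.map e e)).map Prod.snd = ρ.map e := by
    rw [← hπ.1, ← hπ.2, Measure.map_map measurable_fst hpair, Measure.map_map measurable_snd hpair,
      Measure.map_map he measurable_fst, Measure.map_map he measurable_snd]
    exact ⟨rfl, rfl⟩
  obtain ⟨g, hg, hgd, hgi⟩ := exists_measurable_le_lintegral_eq π
    (fun z : E × E => d (e z.1) (e z.2) ^ p)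
  let u : E × E → ℝ≥0∞ := fun z => g z ^ (1 / p) / K z.1
  have hu : Measurable u := (hg.pow_const _).div (hK.comp measurable_fst)
  have huc z : u z ≤ c z.1 z.2 := by
    refine ENNReal.div_le_of_le_mul' (le_trans ?_ (hd z.1 z.2))
    rw [one_div, ENNReal.rpow_inv_le_iff hp]
    exact hgd z
  have hgu z : g z = ((fun z : E × E => K z.1) * u) z ^ p := by
    rw [Pi.mul_apply, ENNReal.mul_div_cancel (hK0 _) (hKt _), ← ENNReal.rpow_mul,
      one_div_mul_cancel hp.ne', ENNReal.rpow_one]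
  calc transportCost d p (μ.map e) (ρ.map e)
      ≤ (∫⁻ z, d z.1 z.2 ^ p ∂(π.map (Prod.map e e))) ^ (1 / p) :=
        ENNReal.rpow_le_rpow (iInf₂_le (π.map (Prod.map e e)) hcoup) (by positivity)
    _ ≤ (∫⁻ z, d (e z.1) (e z.2) ^ p ∂π) ^ (1 / p) :=
        ENNReal.rpow_le_rpow (lintegral_map_le _ _) (by positivity)
    _ = (∫⁻ z, ((fun z : E × E => K z.1) * u) z ^ p ∂π) ^ (1 / p) := by
        simp_rw [hgi, hgu]
    _ ≤ (∫⁻ z, K z.1 ^ q ∂π) ^ (1 / q) * (∫⁻ z, u z ^ (2 : ℝ) ∂π) ^ (1 / 2 : ℝ) :=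
        ENNReal.lintegral_Lp_mul_le_Lq_mul_Lr hp hpq' hpq π
          (hK.comp measurable_fst).aemeasurable hu.aemeasurable
    _ ≤ M * (∫⁻ z, c z.1 z.2 ^ (2 : ℝ) ∂π) ^ (2 : ℝ)⁻¹ := by
        rw [one_div 2]
        gcongr
        · rwa [← lintegral_map (f := fun x => K x ^ q) (by fun_prop) measurable_fst, hπ.1]
        · exact huc _

/-- The transport inequality `𝒯₂` is pushed forward to `𝒯_p` by a map with a random Lipschitz
constant in `L^q`, where `1 / p = 1 / q + 1 / 2`. -/
lemma SatisfiesTp.map [IsProbabilityMeasure μ] (he : Measurable e) {c : E → E → ℝ≥0∞}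
    {d : F → F → ℝ≥0∞} {K : E → ℝ≥0∞} (hK : Measurable K) (hK0 : ∀ x, K x ≠ 0)
    (hKt : ∀ x, K x ≠ ∞) (hd : ∀ x y, d (e x) (e y) ≤ K x * c x y) {p q : ℝ} (hp : 0 < p)
    (hp2 : p < 2) (hpq : 1 / p = 1 / q + 1 / 2) {M a : ℝ} (hM : 0 < M) (ha : 0 < a)
    (hKM : (∫⁻ x, K x ^ q ∂μ) ^ (1 / q) ≤ ENNReal.ofReal M) (h : SatisfiesTp 2 c a μ) :
    SatisfiesTp p d (a * (M ^ 2)⁻¹) (μ.map e) := by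
  intro ν hν
  by_cases hac : ν ≪ μ.map e
  · obtain ⟨ρ, hρ, rfl, hkl⟩ := exists_map_eq_klDiv_eq he hac
    refine (transportCost_map_le he hK hK0 hKt hd hp hp2 hpq (by simpa using hM)
      ENNReal.ofReal_ne_top hKM ρ).trans ?_
    have hconst : 2 / (a * (M ^ 2)⁻¹) = M ^ (2 : ℝ) * (2 / a) := by
      rw [Real.rpow_two]
      field_simp
    rw [← hkl, hconst, ENNReal.ofReal_mul (by positivity), mul_assoc,
      ENNReal.mul_rpow_of_nonneg _ _ (by norm_num : (0 : ℝ) ≤ 1 / 2),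
      ← ENNReal.ofReal_rpow_of_pos hM, ← ENNReal.rpow_mul, mul_one_div_cancel two_ne_zero,
      ENNReal.rpow_one]
    gcongr
    exact h ρ hρ
  · have : ENNReal.ofReal (2 / (a * (M ^ 2)⁻¹)) ≠ 0 := by
      have : 0 < 2 / (a * (M ^ 2)⁻¹) := by positivity
      simpa using this
    rw [InformationTheory.klDiv_of_not_ac hac, ENNReal.mul_top this,
      ENNReal.top_rpow_of_pos (by norm_num)]
    exact le_top

end Pushforward

theorem proposition5p13 {Ω : Type*} [MeasurableSpace Ω] (P : Measure Ω) [IsProbabilityMeasure P]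
    (B : Fin 3 → ℝ≥0 → Ω → ℝ) (hB : IsBrownianThree B P) (p : ℝ) (hp : 1 ≤ p) (hp' : p < 2) :
    MemLp (planarSup B) (dualExponent p) P ∧
    (∀ ε : ℝ, 0 < ε → 0 < projConst P B ε p) ∧
    Tendsto (fun ε => projConst P B ε p) (𝓝[>] 0) (𝓝 0) ∧
    ∀ ε : ℝ, 0 < ε → ∀ Bb : Ω → PathSpace, IsRiemBrownian ε B Bb P → ∀ a : ℝ, 0 < a →
      SatisfiesTp 2 (cameronMartinCost ε) a (P.map Bb) →
      SatisfiesTp p (fun x y => ENNReal.ofReal (riemDist ε x y)) (a * projConst P B ε p)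
        ((P.map Bb).map fun ω => ω.1 1) := by
  have h2p : 0 < 2 - p := by linarith
  have hp0 : 0 < p := by linarith
  have hq1 : 1 ≤ 2 * p / (2 - p) := by
    rw [le_div_iff₀ h2p]
    linarith
  refine ⟨hB.memLp_planarSup ENNReal.ofReal_ne_top, fun ε hε => ?_, ?_, ?_⟩
  · unfold projConst
    positivity
  · have hN : 0 < (eLpNorm (planarSup B) (dualExponent p) P).toReal :=
      hB.eLpNorm_planarSup_pos (by simpa [dualExponent] using by linarith) ENNReal.ofReal_ne_top
    refine tendsto_inv_atTop_zero.comp ((tendsto_pow_atTop two_ne_zero).comp ?_)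
    exact tendsto_atTop_add_const_left _ _
      ((tendsto_inv_nhdsGT_zero.const_mul_atTop two_pos).atTop_mul_const hN)
  · intro ε hε Bb hBb a ha h
    have : IsProbabilityMeasure (P.map Bb) := Measure.isProbabilityMeasure_map hBb.1
    have hS := pathPlanarSup_nonneg
    refine SatisfiesTp.map (q := 2 * p / (2 - p)) (measurable_pathSpace_apply 1)
      (K := fun ω => ENNReal.ofReal (1 + 2 * ε⁻¹ * pathPlanarSup ω)) ?_ (fun ω => ?_)
      (fun ω => ENNReal.ofReal_ne_top) (riemDist_le_mul_cameronMartinCost hε) hp0 hp' ?_ ?_ ha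
      (lintegral_endpoint_lipschitz_le hB hε hBb hq1) h
    · have := measurable_pathPlanarSup
      fun_prop
    · have : 0 < 1 + 2 * ε⁻¹ * pathPlanarSup ω := by have := hS ω; positivity
      simpa using this
    · field_simp
      ring
    · positivity
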